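/- For $J\in\{0,\tfrac12,1,\tfrac32,\dots\}$ let $\mathcal R_J$ be the set of functions $P:\mathbb R\to[0,1]$ of the form $P(\theta)=c_0+\sum_{j=1}^{2J}\big(c_j\cos(j\theta)+s_j\sin(j\theta)\big)$ with real coefficients $c_j=c_j[P]$, $s_j=s_j[P]$. Let $\mathcal Q_J$ be the set of functions $P(\theta)=\mathrm{Tr}(U_\theta\rho U_\theta^\dagger E)$, where $U_\theta=\bigoplus_{j=-J}^{J}\mathbf 1_{n_j}e^{ij\theta}$ (with $j$ running in integer steps) for some finite multiplicities $n_j\ge 0$, $\rho$ is a density matrix, and $E$ is a matrix with $0\le E\le\mathbf 1$, both of the size of $U_\theta$. Then: 1. For every $J\ge 3/2$ and every $P\in\mathcal Q_J$, $\;c_{2J-1}[P]+s_{2J}[P]\le \frac1{\sqrt3}$. 2. For every $J\ge 7/2$, put $\beta=\beta_J=\frac{1}{1+9\cdot4^{-J}}$. The trigonometric polynomial $$p_{J,\beta}(\theta)=\frac12+\frac14\beta\sin(2J\theta)-\frac34\beta\sum_{k=1}^{2J-1}\Big(\frac12\Big)^{2J-k}\sin\Big[k\Big(\frac\pi2+\theta\Big)-J\pi\Big]$$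 belongs to $\mathcal R_J$, has $c_{2J-1}=\frac38\beta$ and $s_{2J}=\frac14\beta$, and so $c_{2J-1}+s_{2J}=0.625\,\beta>\frac1{\sqrt3}$. Hence $p_{J,\beta}\notin\mathcal Q_J$. 3. For $J=\frac32,2,\frac52,3$ let $P_J$ be the trigonometric polynomial of degree $2J$ with the following coefficients (those not listed are zero): - $J=\frac32$: $c_0=\frac25,\ c_2=\frac{48}{125},\ s_1=\frac{6}{25},\ s_3=\frac{32}{125}$; - $J=2$: $c_0=\frac12,\ c_1=-\frac{17}{250},\ c_3=\frac{19}{50},\ s_2=\frac{87}{500},\ s_4=\frac{6}{25}$; - $J=\frac52$: $c_0=0.526,\ c_2=-0.1042,\ c_4=0.3688,\ s_1=-0.0638,\ s_3=0.1922,\ s_5=0.2558$; - $J=3$: $c_0=\frac12,\ c_1=0.0172,\ c_3=-0.0912,\ c_5=0.3752,\ s_2=-0.0432,\ s_4=0.1860,\ s_6=0.2476$. Write $P_J(\theta)=\sum_{k=-2J}^{2J}a_ke^{ik\theta}$, so $a_0=c_0$, and $a_k=\overline{a_{-k}}=\frac12(c_k-is_k)$ for $k\geq 1$. The matrices $Q_J,S_J$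 below, with rows and columns indexed by $0,\dots,2J$, are positive semidefinite and satisfy $a_k=\sum_{0\le j,\,j+k\le 2J}(Q_J)_{j,j+k}$ for all $|k|\le 2J$, $\;1-a_0=\mathrm{Tr}(S_J)$, and $a_k=-\sum_{0\le j,\,j+k\le 2J}(S_J)_{j,j+k}$ for all $0<|k|\le 2J$. Moreover $P_J\in\mathcal R_J$ and $c_{2J-1}[P_J]+s_{2J}[P_J]>\frac1{\sqrt3}$, so $P_J\notin\mathcal Q_J$. Here $$Q_{3/2}=\tfrac1{125}\begin{pmatrix}16&-12i&12&-16i\\12i&9&9i&12\\12&-9i&9&-12i\\16i&12&12i&16\end{pmatrix},\quad S_{3/2}=\tfrac1{125}\begin{pmatrix}24&2i&-12&16i\\-2i&\frac{27}2&11i&-12\\-12&-11i&\frac{27}2&2i\\-16i&-12&-2i&24\end{pmatrix},$$ $$Q_2=10^{-5}\begin{pmatrix}15708&-1436-4105i&1407-4170i&9500&-12000i\\-1436+4105i&7645&-264+4105i&-2814-360i&9500\\1407+4170i&-264-4105i&3294&-264+4105i&1407-4170i\\9500&-2814+360i&-264-4105i&7645&-1436-4105i\\12000i&9500&1407+4170i&-1436+4105i&15708\end{pmatrix},$$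 $$Q_{5/2}=10^{-4}\begin{pmatrix}1663&-319i&-22&-374i&922&-1279i\\319i&739&386i&-238&-213i&922\\-22&-386i&228&185i&-239&-374i\\374i&-238&-185i&228&386i&-22\\922&213i&-239&-386i&739&-319i\\1279i&922&374i&-22&319i&1663\end{pmatrix},$$ $$S_{5/2}=10^{-4}\begin{pmatrix}1464&-663i&540&617i&-922&1279i\\663i&644&389i&-280&-273i&-922\\540&-389i&262&229i&-279&617i\\-617i&-280&-229i&262&389i&540\\-922&273i&-279&-389i&644&-663i\\-1279i&-922&-617i&540&663i&1464\end{pmatrix},$$ $$Q_3=10^{-4}\begin{pmatrix}1560&32-458i&219+97i&-220+97i&-32-460i&938&-1238i\\32+458i&712&8+353i&-179+9i&-8-97i&64-10i&938\\219-97i&8-353i&185&3+105i&-80+4i&-8-97i&-32-460i\\-220-97i&-179-9i&3-105i&86&3+105i&-179+9i&-220+97i\\-32+460i&-8+97i&-80-4i&3-105i&185&8+353i&219+97i\\938&64+10i&-8+97i&-179-9i&8-353i&712&32-458i\\1238i&938&-32+460i&-220-97i&219-97i&32+458i&1560\end{pmatrix},$$ and, for $J=2$ and $J=3$, $(S_J)_{jk}=(-1)^{j+k}\,\overline{(Q_J)_{jk}}$.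 4. Consequently $\mathcal Q_J\subsetneq\mathcal R_J$ for every $J\ge\frac32$. -/

import Mathlib

namespace RotationBox

open Complex Matrix
open scoped ComplexOrder

noncomputable section

/-! Throughout, a spin `J ∈ {0, 1/2, 1, 3/2, …}` is represented by the natural number `N = 2J`. -/

/-- The real trigonometric polynomial `c₀ + ∑_{j=1}^{N} (c_j cos(jθ) + s_j sin(jθ))`, of degree at
most `N`. Only `c₀, …, c_N` and `s₁, …, s_N` are used. -/
def trigPoly (N : ℕ) (c s : ℕ → ℝ) (θ : ℝ) : ℝ :=
  c 0 + ∑ j ∈ Finset.Icc 1 N, (c j * Real.cos (j * θ) + s j * Real.sin (j * θ))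

/-- The set `R_J` of (two-outcome) spin-`J` correlations, `N = 2J`: the functions
`θ ↦ P(+1|θ)` that are trigonometric polynomials of degree at most `2J` with values in `[0,1]`. -/
def generalCorrelations (N : ℕ) : Set (ℝ → ℝ) :=
  {P | (∃ c s : ℕ → ℝ, ∀ θ, P θ = trigPoly N c s θ) ∧ ∀ θ, 0 ≤ P θ ∧ P θ ≤ 1}

/-- The representation `U_θ = ⨁_{j=-J}^{J} 1_{n_j} e^{ijθ}` of rotations, `N = 2J`. The block with
index `k ∈ {0, …, N}` has weight `j = k - J` and (possibly zero) multiplicity `n k`. -/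
def rotation {N : ℕ} (n : Fin (N + 1) → ℕ) (θ : ℝ) :
    Matrix (Σ k : Fin (N + 1), Fin (n k)) (Σ k : Fin (N + 1), Fin (n k)) ℂ :=
  Matrix.diagonal fun x => Complex.exp (I * (((x.1 : ℕ) : ℂ) - (N : ℂ) / 2) * (θ : ℂ))

/-- The set `Q_J` of (two-outcome) quantum spin-`J` correlations, `N = 2J`: the functions
`θ ↦ P(+1|θ) = Tr(U_θ ρ U_θ† E)` with arbitrary finite multiplicities, a density matrix `ρ`, and
a two-outcome POVM `{E, 1 - E}`. -/
def quantumCorrelations (N : ℕ) : Set (ℝ → ℝ) :=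
  {P | ∃ (n : Fin (N + 1) → ℕ)
      (ρ E : Matrix (Σ k : Fin (N + 1), Fin (n k)) (Σ k : Fin (N + 1), Fin (n k)) ℂ),
      (ρ.PosSemidef ∧ ρ.trace = 1) ∧ (E.PosSemidef ∧ (1 - E).PosSemidef) ∧
      ∀ θ : ℝ, ((P θ : ℝ) : ℂ) = (rotation n θ * ρ * (rotation n θ)ᴴ * E).trace}

/-- The explicit trigonometric polynomial `p_{J,β}`, `N = 2J`. -/
def explicitPoly (N : ℕ) (β θ : ℝ) : ℝ :=
  1 / 2 + 1 / 4 * β * Real.sin (N * θ)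
    - 3 / 4 * β * ∑ k ∈ Finset.Icc 1 (N - 1),
        (1 / 2 : ℝ) ^ (N - k) * Real.sin (k * (Real.pi / 2 + θ) - (N : ℝ) / 2 * Real.pi)

/-- The scaling factor `1 / (1 + 9 · 4^{-J})`, `N = 2J`. -/
def scaling (N : ℕ) : ℝ := 1 / (1 + 9 / 2 ^ N)

/-- The complex coefficient `a_k` of `e^{ikθ}` in `trigPoly N c s`, for `-N ≤ k ≤ N`. -/
def complexCoeff (c s : ℕ → ℝ) (k : ℤ) : ℂ :=
  if k = 0 then (c 0 : ℂ)
  else if 0 < k then ((c k.natAbs : ℂ) - I * (s k.natAbs : ℂ)) / 2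
  else ((c k.natAbs : ℂ) + I * (s k.natAbs : ℂ)) / 2

/-- The sum `∑_{0 ≤ j, j+k ≤ N} M_{j,j+k}` along the `k`-th diagonal. -/
def diagSum {N : ℕ} (M : Matrix (Fin (N + 1)) (Fin (N + 1)) ℂ) (k : ℤ) : ℂ :=
  ∑ i : Fin (N + 1), ∑ j : Fin (N + 1), if ((j : ℕ) : ℤ) - ((i : ℕ) : ℤ) = k then M i j else 0

/-- The positive semidefinite matrices `Q`, `S` certify that `trigPoly N c s` has values in
`[0,1]`. -/
def IsCertificate (N : ℕ) (c s : ℕ → ℝ) (Q S : Matrix (Fin (N + 1)) (Fin (N + 1)) ℂ) : Prop :=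
  Q.PosSemidef ∧ S.PosSemidef ∧
  (∀ k : ℤ, -(N : ℤ) ≤ k → k ≤ (N : ℤ) → complexCoeff c s k = diagSum Q k) ∧
  1 - complexCoeff c s 0 = S.trace ∧
  (∀ k : ℤ, -(N : ℤ) ≤ k → k ≤ (N : ℤ) → k ≠ 0 → complexCoeff c s k = -diagSum S k)

/-- A finite list of coefficients, continued by zero. -/
def coeffs (l : List ℝ) (j : ℕ) : ℝ := l.getD j 0

/-! The explicit examples: coefficients `c₀, …, c_N` and `s₀, …, s_N` (with `s₀ = 0`), and the
certificate matrices, for `N = 3, 4, 5, 6`. -/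

def c3 : ℕ → ℝ := coeffs [2 / 5, 0, 48 / 125, 0]
def s3 : ℕ → ℝ := coeffs [0, 6 / 25, 0, 32 / 125]

def Q3 : Matrix (Fin 4) (Fin 4) ℂ :=
  (1 / 125 : ℂ) •
  !![16, -12 * I, 12, -16 * I;
     12 * I, 9, 9 * I, 12;
     12, -9 * I, 9, -12 * I;
     16 * I, 12, 12 * I, 16]

def S3 : Matrix (Fin 4) (Fin 4) ℂ :=
  (1 / 125 : ℂ) •
  !![24, 2 * I, -12, 16 * I;
     -2 * I, 27 / 2, 11 * I, -12;
     -12, -11 * I, 27 / 2, 2 * I;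
     -16 * I, -12, -2 * I, 24]

def c4 : ℕ → ℝ := coeffs [1 / 2, -17 / 250, 0, 19 / 50, 0]
def s4 : ℕ → ℝ := coeffs [0, 0, 87 / 500, 0, 6 / 25]

def Q4 : Matrix (Fin 5) (Fin 5) ℂ :=
  (1 / 100000 : ℂ) •
  !![15708, -1436 - 4105 * I, 1407 - 4170 * I, 9500, -12000 * I;
     -1436 + 4105 * I, 7645, -264 + 4105 * I, -2814 - 360 * I, 9500;
     1407 + 4170 * I, -264 - 4105 * I, 3294, -264 + 4105 * I, 1407 - 4170 * I;
     9500, -2814 + 360 * I, -264 - 4105 * I, 7645, -1436 - 4105 * I;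
     12000 * I, 9500, 1407 + 4170 * I, -1436 + 4105 * I, 15708]

def S4 : Matrix (Fin 5) (Fin 5) ℂ :=
  (1 / 100000 : ℂ) •
  !![15708, 1436 - 4105 * I, 1407 + 4170 * I, -9500, 12000 * I;
     1436 + 4105 * I, 7645, 264 + 4105 * I, -2814 + 360 * I, -9500;
     1407 - 4170 * I, 264 - 4105 * I, 3294, 264 + 4105 * I, 1407 + 4170 * I;
     -9500, -2814 - 360 * I, 264 - 4105 * I, 7645, 1436 - 4105 * I;
     -12000 * I, -9500, 1407 - 4170 * I, 1436 + 4105 * I, 15708]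

def c5 : ℕ → ℝ := coeffs [0.526, 0, -0.1042, 0, 0.3688, 0]
def s5 : ℕ → ℝ := coeffs [0, -0.0638, 0, 0.1922, 0, 0.2558]

def Q5 : Matrix (Fin 6) (Fin 6) ℂ :=
  (1 / 10000 : ℂ) •
  !![1663, -319 * I, -22, -374 * I, 922, -1279 * I;
     319 * I, 739, 386 * I, -238, -213 * I, 922;
     -22, -386 * I, 228, 185 * I, -239, -374 * I;
     374 * I, -238, -185 * I, 228, 386 * I, -22;
     922, 213 * I, -239, -386 * I, 739, -319 * I;
     1279 * I, 922, 374 * I, -22, 319 * I, 1663]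

def S5 : Matrix (Fin 6) (Fin 6) ℂ :=
  (1 / 10000 : ℂ) •
  !![1464, -663 * I, 540, 617 * I, -922, 1279 * I;
     663 * I, 644, 389 * I, -280, -273 * I, -922;
     540, -389 * I, 262, 229 * I, -279, 617 * I;
     -617 * I, -280, -229 * I, 262, 389 * I, 540;
     -922, 273 * I, -279, -389 * I, 644, -663 * I;
     -1279 * I, -922, -617 * I, 540, 663 * I, 1464]

def c6 : ℕ → ℝ := coeffs [1 / 2, 0.0172, 0, -0.0912, 0, 0.3752, 0]
def s6 : ℕ → ℝ := coeffs [0, 0, -0.0432, 0, 0.1860, 0, 0.2476]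

def Q6 : Matrix (Fin 7) (Fin 7) ℂ :=
  (1 / 10000 : ℂ) •
  !![1560, 32 - 458 * I, 219 + 97 * I, -220 + 97 * I, -32 - 460 * I, 938, -1238 * I;
     32 + 458 * I, 712, 8 + 353 * I, -179 + 9 * I, -8 - 97 * I, 64 - 10 * I, 938;
     219 - 97 * I, 8 - 353 * I, 185, 3 + 105 * I, -80 + 4 * I, -8 - 97 * I, -32 - 460 * I;
     -220 - 97 * I, -179 - 9 * I, 3 - 105 * I, 86, 3 + 105 * I, -179 + 9 * I, -220 + 97 * I;
     -32 + 460 * I, -8 + 97 * I, -80 - 4 * I, 3 - 105 * I, 185, 8 + 353 * I, 219 + 97 * I;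
     938, 64 + 10 * I, -8 + 97 * I, -179 - 9 * I, 8 - 353 * I, 712, 32 - 458 * I;
     1238 * I, 938, -32 + 460 * I, -220 - 97 * I, 219 - 97 * I, 32 + 458 * I, 1560]

def S6 : Matrix (Fin 7) (Fin 7) ℂ :=
  (1 / 10000 : ℂ) •
  !![1560, -32 - 458 * I, 219 - 97 * I, 220 + 97 * I, -32 + 460 * I, -938, 1238 * I;
     -32 + 458 * I, 712, -8 + 353 * I, -179 - 9 * I, 8 - 97 * I, 64 + 10 * I, -938;
     219 + 97 * I, -8 - 353 * I, 185, -3 + 105 * I, -80 - 4 * I, 8 - 97 * I, -32 + 460 * I;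
     220 - 97 * I, -179 + 9 * I, -3 - 105 * I, 86, -3 + 105 * I, -179 - 9 * I, 220 + 97 * I;
     -32 - 460 * I, 8 + 97 * I, -80 + 4 * I, -3 - 105 * I, 185, -8 + 353 * I, 219 - 97 * I;
     -938, 64 - 10 * I, 8 + 97 * I, -179 + 9 * I, -8 - 353 * I, 712, -32 - 458 * I;
     -1238 * I, -938, -32 - 460 * I, 220 - 97 * I, 219 + 97 * I, -32 + 458 * I, 1560]

/-- The trigonometric polynomial with coefficients `c`, `s` is a non-quantum spin-`J` correlation
(`N = 2J`) that is certified by `Q`, `S` and has `c_{2J-1} + s_{2J} > 1/√3`. -/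
def IsCertifiedGap (N : ℕ) (c s : ℕ → ℝ) (Q S : Matrix (Fin (N + 1)) (Fin (N + 1)) ℂ) : Prop :=
  IsCertificate N c s Q S ∧
  trigPoly N c s ∈ generalCorrelations N ∧
  1 / √3 < c (N - 1) + s N ∧
  trigPoly N c s ∉ quantumCorrelations N

end

end RotationBox

namespace RotationBox

open Complex Matrix
open scoped ComplexOrder

/-! A trigonometric polynomial can be written `P(θ) = v* G v` with `v = (e^{ikθ})_k`, and its
Fourier coefficient `a_k` is then the sum of the `k`-th diagonal of `G` (`phaseVec_form`).

For a quantum correlation, compressing the Schur product `ρᵀ ⊙ E` to one index per weight gives such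
a `G` with `0 ≤ G ≤ diag(d)`, where `d` is a probability vector
(`exists_reduced_of_mem_quantumCorrelations`). By uniqueness of Fourier coefficients, `c_{N-1} +
s_N` depends only on the corner entries `G_{0,N-1}`, `G_{1,N}`, `G_{0,N}`, and four test vectors
bound it by `1/√3` (`offDiagonal_bound`, `quantum_bound`).

A general correlation escapes this bound. Put `w = e^{i(π/2+θ)}`. Up to a unimodular factor, the
oscillating part of `explicitPoly` is `β` times the imaginary part of a polynomial close to `w^N
(w-2) / (2(2w-1))`, which has modulus `1/2` on the unit circle. The deviation is `O(2^{-N})`, and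
`scaling` absorbs it (`norm_explicit_le`). The resulting value `0.625 β` exceeds `1/√3` from `N = 7`
on. For `N = 3, 4, 5, 6`, positive semidefinite matrices representing `P` and `1 - P` do the job,
their positivity shown by exact `LDLᴴ` factorizations or by symmetry. -/

/-! ### Exponential sums and uniqueness of Fourier coefficients. -/

/-- The character `θ ↦ e^{ikθ}` of the additive group of real numbers. -/
noncomputable def expChar (k : ℤ) : Multiplicative ℝ →* ℂ where
  toFun θ := Complex.exp (I * k * (Multiplicative.toAdd θ : ℝ))
  map_one' := by simp
  map_mul' x y := by rw [← Complex.exp_add]; simp [mul_add]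

lemma expChar_injective : Function.Injective expChar := by
  intro m n h
  by_contra hmn
  have hne : (((m - n : ℤ) : ℝ)) ≠ 0 := by exact_mod_cast sub_ne_zero.mpr hmn
  -- At `θ = π/(m-n)` the two characters differ by the factor `e^{iπ} = -1`.
  have h1 := DFunLike.congr_fun h (Multiplicative.ofAdd (Real.pi / ((m - n : ℤ) : ℝ)))
  simp only [expChar, MonoidHom.coe_mk, OneHom.coe_mk, toAdd_ofAdd] at h1
  have h2 : Complex.exp (I * m * ((Real.pi / ((m - n : ℤ) : ℝ) : ℝ) : ℂ))
      = Complex.exp (Real.pi * I) *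
        Complex.exp (I * n * ((Real.pi / ((m - n : ℤ) : ℝ) : ℝ) : ℂ)) := by
    rw [← Complex.exp_add]
    congr 1
    have hne' : (m : ℂ) - n ≠ 0 := by
      have : ((((m - n : ℤ) : ℝ)) : ℂ) ≠ 0 := by exact_mod_cast hne
      push_cast at this
      exact this
    push_cast
    field_simp
    ring
  rw [h2, Complex.exp_pi_mul_I] at h1
  have h3 := Complex.exp_ne_zero (I * n * ((Real.pi / ((m - n : ℤ) : ℝ) : ℝ) : ℂ))
  apply h3
  linear_combination (-1 / 2 : ℂ) * h1

/-- Uniqueness of the coefficients of a trigonometric polynomial. -/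
lemma coeff_eq_of_expSum_eq (s : Finset ℤ) (a b : ℤ → ℂ)
    (h : ∀ θ : ℝ, ∑ m ∈ s, a m * Complex.exp (I * m * θ) = ∑ m ∈ s, b m * Complex.exp (I * m * θ)) :
    ∀ m ∈ s, a m = b m := by
  -- Dedekind's independence of characters replaces the usual orthogonality integrals.
  have hli := (linearIndependent_monoidHom (Multiplicative ℝ) ℂ).comp expChar expChar_injective
  have := linearIndependent_iff'.mp hli s (fun m => a m - b m) ?_
  · intro m hm
    exact sub_eq_zero.mp (this m hm)
  · ext θ
    have := h (Multiplicative.toAdd θ)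
    simp only [Function.comp, Finset.sum_apply, Pi.smul_apply, smul_eq_mul, Pi.zero_apply,
      sub_mul, Finset.sum_sub_distrib]
    exact sub_eq_zero.mpr this

lemma trigPoly_succ (N : ℕ) (c s : ℕ → ℝ) (θ : ℝ) :
    trigPoly (N + 1) c s θ = trigPoly N c s θ
      + (c (N + 1) * Real.cos (((N : ℝ) + 1) * θ) + s (N + 1) * Real.sin (((N : ℝ) + 1) * θ)) := by
  simp [trigPoly, Finset.sum_Icc_succ_top, add_assoc]

lemma trigPoly_eq_expSum (N : ℕ) (c s : ℕ → ℝ) (θ : ℝ) :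
    (trigPoly N c s θ : ℂ)
      = ∑ m ∈ Finset.Icc (-(N : ℤ)) N, complexCoeff c s m * Complex.exp (I * m * θ) := by
  induction N with
  | zero => simp [trigPoly, complexCoeff]
  | succ N ih =>
    rw [trigPoly_succ, Nat.cast_add, Nat.cast_one, Finset.Icc_succ_succ,
      Finset.sum_union (by simp), Finset.sum_pair (by lia), ← ih]
    have e1 : complexCoeff c s (-((N : ℤ) + 1)) = (c (N + 1) + I * s (N + 1)) / 2 := by
      have : ¬ (0 : ℤ) < -((N : ℤ) + 1) := by lia
      have h0 : ¬ -((N : ℤ) + 1) = 0 := by lia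
      have hn : (-((N : ℤ) + 1)).natAbs = N + 1 := by lia
      simp only [complexCoeff, this, h0, hn, if_false]
    have e2 : complexCoeff c s ((N : ℤ) + 1) = (c (N + 1) - I * s (N + 1)) / 2 := by
      have : (0 : ℤ) < ((N : ℤ) + 1) := by lia
      have h0 : ¬ ((N : ℤ) + 1) = 0 := by lia
      have hn : ((N : ℤ) + 1).natAbs = N + 1 := by lia
      simp only [complexCoeff, this, h0, hn, if_false, if_true]
    rw [e1, e2]
    push_cast
    rw [show I * (-((N : ℂ) + 1)) * θ = -(((N + 1) * θ) * I) by ring,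
      show I * ((N : ℂ) + 1) * θ = ((N + 1) * θ) * I by ring, ← neg_mul, Complex.exp_mul_I,
      Complex.exp_mul_I, Complex.cos_neg, Complex.sin_neg]
    linear_combination ((s (N + 1) : ℂ) * Complex.sin ((N + 1) * θ)) * I_sq

/-! ### Diagonal sums and quadratic forms in the phase vector. -/

lemma expSum_diagSum {N : ℕ} (M : Matrix (Fin (N + 1)) (Fin (N + 1)) ℂ) (θ : ℝ) :
    ∑ m ∈ Finset.Icc (-(N : ℤ)) N, diagSum M m * Complex.exp (I * m * θ)
      = ∑ i, ∑ j, M i j * Complex.exp (I * (((j : ℕ) : ℂ) - ((i : ℕ) : ℂ)) * θ) := by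
  simp only [diagSum, Finset.sum_mul]
  rw [Finset.sum_comm]
  refine Finset.sum_congr rfl fun i _ => ?_
  rw [Finset.sum_comm]
  refine Finset.sum_congr rfl fun j _ => ?_
  simp only [ite_mul, zero_mul]
  rw [Finset.sum_ite_eq, if_pos]
  · push_cast; rfl
  · rw [Finset.mem_Icc]; have := i.2; have := j.2; lia

/-- The vector `(e^{ikθ})_k`. -/
noncomputable def phaseVec (N : ℕ) (θ : ℝ) : Fin (N + 1) → ℂ :=
  fun k => Complex.exp (I * ((k : ℕ) : ℂ) * θ)

lemma star_phaseVec (N : ℕ) (θ : ℝ) (k : Fin (N + 1)) :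
    star (phaseVec N θ k) = Complex.exp (-(I * ((k : ℕ) : ℂ) * θ)) := by
  simp [phaseVec, ← Complex.exp_conj]

lemma phaseVec_form {N : ℕ} (M : Matrix (Fin (N + 1)) (Fin (N + 1)) ℂ) (θ : ℝ) :
    star (phaseVec N θ) ⬝ᵥ (M *ᵥ phaseVec N θ)
      = ∑ m ∈ Finset.Icc (-(N : ℤ)) N, diagSum M m * Complex.exp (I * m * θ) := by
  rw [expSum_diagSum]
  simp only [dotProduct, mulVec, Finset.mul_sum, Pi.star_apply]
  refine Finset.sum_congr rfl fun i _ => Finset.sum_congr rfl fun j _ => ?_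
  rw [star_phaseVec, phaseVec, mul_left_comm, ← Complex.exp_add]
  ring_nf

lemma diagSum_zero {N : ℕ} (M : Matrix (Fin (N + 1)) (Fin (N + 1)) ℂ) :
    diagSum M 0 = M.trace := by
  have h : ∀ i j : Fin (N + 1), (((j : ℕ) : ℤ) - ((i : ℕ) : ℤ) = 0) ↔ i = j := by
    intro i j; rw [Fin.ext_iff]; lia
  simp [diagSum, h, Matrix.trace]

lemma star_diagSum {N : ℕ} {M : Matrix (Fin (N + 1)) (Fin (N + 1)) ℂ} (hM : M.IsHermitian)
    (k : ℤ) : star (diagSum M k) = diagSum M (-k) := by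
  simp only [diagSum, star_sum, apply_ite star, star_zero]
  rw [Finset.sum_comm]
  refine Finset.sum_congr rfl fun i _ => Finset.sum_congr rfl fun j _ => ?_
  rw [hM.apply]
  refine if_congr ?_ rfl rfl
  lia

/-- The single-sum form lets `simp` evaluate diagonals of concrete matrices. -/
lemma diagSum_natCast {N : ℕ} (M : Matrix (Fin (N + 1)) (Fin (N + 1)) ℂ) (k : ℕ) :
    diagSum M k = ∑ i : Fin (N + 1), if h : (i : ℕ) + k < N + 1 then M i ⟨i + k, h⟩ else 0 := by
  refine Finset.sum_congr rfl fun i _ => ?_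
  split_ifs with h
  · rw [Finset.sum_eq_single ⟨i + k, h⟩]
    · simp
    · intro j _ hj
      rw [if_neg]
      intro h'
      exact hj (Fin.ext (by simp only; lia))
    · simp
  · refine Finset.sum_eq_zero fun j _ => if_neg ?_
    have := j.2
    lia

/-- A certificate proves that the trigonometric polynomial has values in `[0,1]`. -/
lemma IsCertificate.mem_generalCorrelations {N : ℕ} {c s : ℕ → ℝ}
    {Q S : Matrix (Fin (N + 1)) (Fin (N + 1)) ℂ} (h : IsCertificate N c s Q S) :
    trigPoly N c s ∈ generalCorrelations N := by
  obtain ⟨hQ, hS, h1, h2, h3⟩ := h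
  refine ⟨⟨c, s, fun _ => rfl⟩, fun θ => ?_⟩
  have eQ : star (phaseVec N θ) ⬝ᵥ (Q *ᵥ phaseVec N θ) = (trigPoly N c s θ : ℂ) := by
    rw [phaseVec_form, trigPoly_eq_expSum]
    refine Finset.sum_congr rfl fun m hm => ?_
    rw [Finset.mem_Icc] at hm
    rw [h1 m hm.1 hm.2]
  -- The certificate prescribes the diagonal sums of `S` as the Fourier coefficients of `1 - P`.
  have eS : star (phaseVec N θ) ⬝ᵥ (S *ᵥ phaseVec N θ) = 1 - (trigPoly N c s θ : ℂ) := by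
    have e0 : ∑ m ∈ Finset.Icc (-(N : ℤ)) N,
        (if m = 0 then (1 : ℂ) else 0) * Complex.exp (I * m * θ) = 1 := by
      simp
    rw [phaseVec_form, trigPoly_eq_expSum, ← e0, ← Finset.sum_sub_distrib]
    refine Finset.sum_congr rfl fun m hm => ?_
    rw [Finset.mem_Icc] at hm
    rw [← sub_mul]
    congr 1
    split_ifs with hm0
    · rw [hm0, diagSum_zero, h2]
    · rw [h3 m hm.1 hm.2 hm0]; ring
  have pQ := hQ.dotProduct_mulVec_nonneg (phaseVec N θ)
  have pS := hS.dotProduct_mulVec_nonneg (phaseVec N θ)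
  rw [eQ] at pQ
  rw [eS] at pS
  constructor
  · exact_mod_cast pQ
  · rw [sub_nonneg] at pS
    exact_mod_cast pS

/-! ### Reduction of quantum correlations to one index per weight. -/

/-- The indicator matrix of the fibres of a map `f`. -/
def fiberMatrix {α κ : Type*} [DecidableEq κ] (f : α → κ) : Matrix α κ ℂ :=
  Matrix.of fun x k => if f x = k then 1 else 0

lemma fiberMatrix_conj {α κ : Type*} [Fintype α] [DecidableEq κ]
    (f : α → κ) (M : Matrix α α ℂ) (i j : κ) :
    ((fiberMatrix f)ᴴ * M * fiberMatrix f) i j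
      = ∑ x, ∑ y, if f x = i ∧ f y = j then M x y else 0 := by
  simp only [Matrix.mul_apply, conjTranspose_apply, fiberMatrix, of_apply, Finset.sum_mul]
  rw [Finset.sum_comm]
  refine Finset.sum_congr rfl fun x _ => Finset.sum_congr rfl fun y _ => ?_
  by_cases h1 : f x = i <;> by_cases h2 : f y = j <;> simp [h1, h2]

/-- A quantum correlation is given by a positive semidefinite matrix `G` that is dominated by a
probability distribution `d` on the weights. -/
lemma exists_reduced_of_mem_quantumCorrelations {N : ℕ} {P : ℝ → ℝ}
    (hP : P ∈ quantumCorrelations N) :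
    ∃ (G : Matrix (Fin (N + 1)) (Fin (N + 1)) ℂ) (d : Fin (N + 1) → ℝ),
      (∀ k, 0 ≤ d k) ∧ ∑ k, d k = 1 ∧ G.PosSemidef ∧
      (Matrix.diagonal (fun k => (d k : ℂ)) - G).PosSemidef ∧
      ∀ θ : ℝ, (P θ : ℂ) = star (phaseVec N θ) ⬝ᵥ (G *ᵥ phaseVec N θ) := by
  obtain ⟨n, ρ, E, ⟨hρ, htr⟩, ⟨hE, hE'⟩, hθ⟩ := hP
  let f : (Σ k : Fin (N + 1), Fin (n k)) → Fin (N + 1) := Sigma.fst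
  have hre : ∀ x, ((ρ x x).re : ℂ) = ρ x x := fun x => by
    have := hρ.diag_nonneg (i := x)
    rw [Complex.nonneg_iff] at this
    exact Complex.ext rfl this.2
  refine ⟨(fiberMatrix f)ᴴ * (ρᵀ ⊙ E) * fiberMatrix f,
    fun k => ∑ x, if f x = k then (ρ x x).re else 0, ?_, ?_, ?_, ?_, ?_⟩
  · intro k
    refine Finset.sum_nonneg fun x _ => ?_
    split_ifs
    · exact (Complex.nonneg_iff.mp (hρ.diag_nonneg (i := x))).1
    · exact le_rfl
  · rw [Finset.sum_comm]
    simp only [Finset.sum_ite_eq, Finset.mem_univ, if_true]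
    have := congrArg Complex.re htr
    simpa [Matrix.trace] using this
  -- Schur product theorem, followed by compression.
  · exact (hρ.transpose.hadamard hE).conjTranspose_mul_mul_same _
  -- The same for `1 - E`: `ρᵀ ⊙ 1` is the diagonal of `ρ`, and its compression is `diag(d)` because
  -- fibres over distinct weights are disjoint.
  · have h := (hρ.transpose.hadamard hE').conjTranspose_mul_mul_same (fiberMatrix f)
    refine (congrArg Matrix.PosSemidef ?_).mpr h
    ext i j
    rw [Matrix.sub_apply, fiberMatrix_conj, fiberMatrix_conj]
    have : ∀ x y, (if f x = i ∧ f y = j then (ρᵀ ⊙ (1 - E)) x y else 0)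
        = (if x = y then (if f x = i ∧ f x = j then ρ x x else 0) else 0)
          - (if f x = i ∧ f y = j then (ρᵀ ⊙ E) x y else 0) := by
      intro x y
      by_cases hxy : x = y
      · subst hxy
        by_cases h : f x = i ∧ f x = j
        · simp only [if_pos h, Matrix.hadamard_apply, mul_sub, transpose_apply, Matrix.sub_apply,
            one_apply_eq, mul_one, if_true]
        · simp only [if_neg h, if_true, sub_zero]
      · by_cases h : f x = i ∧ f y = j <;> simp [h, hxy, Matrix.hadamard_apply]
    simp only [this, Finset.sum_sub_distrib, Finset.sum_ite_eq, Finset.mem_univ, if_true]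
    congr 1
    by_cases hij : i = j
    · subst hij
      simp only [diagonal_apply_eq, and_self]
      push_cast
      refine Finset.sum_congr rfl fun x _ => ?_
      split_ifs
      · exact hre x
      · simp
    · rw [diagonal_apply_ne _ hij]
      symm
      refine Finset.sum_eq_zero fun x _ => if_neg ?_
      rintro ⟨h1, h2⟩
      exact hij (h1.symm.trans h2)
  · intro θ
    rw [hθ θ]
    -- The shift by `N/2` in the weights cancels between `U_θ` and its adjoint, so `phaseVec` with
    -- weights `0, …, N` suffices.
    have hL : (rotation n θ * ρ * (rotation n θ)ᴴ * E).trace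
        = ∑ x, ∑ y, star (phaseVec N θ (f x)) * (ρᵀ ⊙ E) x y * phaseVec N θ (f y) := by
      rw [Matrix.trace, Finset.sum_comm]
      refine Finset.sum_congr rfl fun y _ => ?_
      rw [Matrix.diag_apply, Matrix.mul_apply]
      refine Finset.sum_congr rfl fun x _ => ?_
      rw [rotation, diagonal_conjTranspose, mul_diagonal, diagonal_mul, hadamard_apply,
        transpose_apply, star_phaseVec, phaseVec, Pi.star_apply, Complex.star_def,
        ← Complex.exp_conj]
      simp only [map_mul, map_sub, Complex.conj_I, Complex.conj_ofReal, map_natCast, map_div₀,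
        map_ofNat]
      have : ∀ a b u v p q: ℂ, Complex.exp a * Complex.exp b = Complex.exp u * Complex.exp v →
          Complex.exp a * p * Complex.exp b * q = Complex.exp u * (p * q) * Complex.exp v := by
        intro a b u v p q h
        linear_combination p * q * h
      apply this
      rw [← Complex.exp_add, ← Complex.exp_add]
      congr 1
      simp only [f]
      ring
    rw [hL]
    simp only [dotProduct, mulVec, Pi.star_apply, fiberMatrix_conj, Finset.mul_sum, Finset.sum_mul]
    symm
    have : ∀ i j x y, star (phaseVec N θ i) * ((if f x = i ∧ f y = j then (ρᵀ ⊙ E) x y else 0)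
          * phaseVec N θ j)
        = if f x = i then (if f y = j then
          star (phaseVec N θ i) * (ρᵀ ⊙ E) x y * phaseVec N θ j else 0) else 0 := by
      intro i j x y
      by_cases h1 : f x = i <;> by_cases h2 : f y = j <;> simp [h1, h2, mul_assoc]
    simp only [this]
    calc _ = ∑ i, ∑ x, ∑ j, ∑ y, if f x = i then (if f y = j then
          star (phaseVec N θ i) * (ρᵀ ⊙ E) x y * phaseVec N θ j else 0) else 0 :=
          Finset.sum_congr rfl fun i _ => Finset.sum_comm
      _ = ∑ x, ∑ i, ∑ j, ∑ y, if f x = i then (if f y = j then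
          star (phaseVec N θ i) * (ρᵀ ⊙ E) x y * phaseVec N θ j else 0) else 0 := Finset.sum_comm
      _ = ∑ x, ∑ i, ∑ y, ∑ j, if f x = i then (if f y = j then
          star (phaseVec N θ i) * (ρᵀ ⊙ E) x y * phaseVec N θ j else 0) else 0 :=
          Finset.sum_congr rfl fun x _ => Finset.sum_congr rfl fun i _ => Finset.sum_comm
      _ = ∑ x, ∑ y, ∑ i, ∑ j, if f x = i then (if f y = j then
          star (phaseVec N θ i) * (ρᵀ ⊙ E) x y * phaseVec N θ j else 0) else 0 :=
          Finset.sum_congr rfl fun x _ => Finset.sum_comm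
      _ = _ := by
          refine Finset.sum_congr rfl fun x _ => Finset.sum_congr rfl fun y _ => ?_
          rw [Finset.sum_eq_single (f x), Finset.sum_eq_single (f y)]
          · simp
          · intro j _ hj; simp [hj.symm]
          · simp
          · intro i _ hi; simp [hi.symm]
          · simp

lemma complexCoeff_natCast (c s : ℕ → ℝ) {k : ℕ} (hk : 0 < k) :
    complexCoeff c s k = ((c k : ℂ) - I * s k) / 2 := by
  simp [complexCoeff, hk, hk.ne']

lemma complexCoeff_neg_natCast (c s : ℕ → ℝ) {k : ℕ} (hk : 0 < k) :
    complexCoeff c s (-(k : ℤ)) = ((c k : ℂ) + I * s k) / 2 := by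
  have h0 : ¬ (0 : ℤ) < -(k : ℤ) := by lia
  have h1 : ¬ -(k : ℤ) = 0 := by lia
  simp only [complexCoeff, h0, h1, if_false, Int.natAbs_neg, Int.natAbs_natCast]

lemma quantumCorrelations_subset (N : ℕ) : quantumCorrelations N ⊆ generalCorrelations N := by
  intro P hP
  obtain ⟨G, d, hd, hd1, hG, hdG, hPG⟩ := exists_reduced_of_mem_quantumCorrelations hP
  have hherm := star_diagSum hG.isHermitian
  refine ⟨⟨fun k => if k = 0 then (diagSum G 0).re else 2 * (diagSum G k).re,
    fun k => -2 * (diagSum G k).im, fun θ => ?_⟩, fun θ => ?_⟩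
  · apply Complex.ofReal_injective
    rw [hPG, phaseVec_form, trigPoly_eq_expSum]
    refine Finset.sum_congr rfl fun m _ => ?_
    congr 1
    rcases lt_trichotomy m 0 with hm | hm | hm
    · obtain ⟨k, rfl⟩ : ∃ k : ℕ, m = -(k : ℤ) := ⟨m.natAbs, by lia⟩
      have hk : k ≠ 0 := by rintro rfl; simp at hm
      rw [← hherm]
      rw [complexCoeff_neg_natCast _ _ (by lia)]
      apply Complex.ext <;> simp [hk, neg_div]
    · subst hm
      have := hherm 0
      rw [neg_zero] at this
      have him : (diagSum G 0).im = 0 := Complex.conj_eq_iff_im.mp this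
      apply Complex.ext <;> simp [complexCoeff, him]
    · obtain ⟨k, rfl⟩ : ∃ k : ℕ, m = (k : ℤ) := ⟨m.natAbs, by lia⟩
      have hk : k ≠ 0 := by rintro rfl; simp at hm
      have hk' : 0 < k := by lia
      apply Complex.ext <;> simp [complexCoeff, hk, hk']
  · have p1 := hG.dotProduct_mulVec_nonneg (phaseVec N θ)
    have p2 := hdG.dotProduct_mulVec_nonneg (phaseVec N θ)
    -- Phases have modulus one, so `diag(d)` evaluates to the total mass `1`; this yields `P ≤ 1`.
    have hD : star (phaseVec N θ) ⬝ᵥ (Matrix.diagonal (fun k => (d k : ℂ)) *ᵥ phaseVec N θ) = 1 := by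
      simp only [dotProduct, mulVec_diagonal, Pi.star_apply]
      rw [← Complex.ofReal_one, ← hd1]
      push_cast
      refine Finset.sum_congr rfl fun k _ => ?_
      rw [star_phaseVec, phaseVec, mul_left_comm, ← Complex.exp_add]
      simp
    rw [← hPG] at p1
    rw [sub_mulVec, dotProduct_sub, hD, ← hPG, sub_nonneg] at p2
    exact ⟨by exact_mod_cast p1, by exact_mod_cast p2⟩

/-! ### The quantum bound. -/

/-- The norm bound for the triangular truncation of `2 × 2` matrices, in terms of the off-diagonal
block of a positive semidefinite `4 × 4` matrix. -/
lemma offDiagonal_bound (G : Matrix (Fin 4) (Fin 4) ℂ) (d : Fin 4 → ℝ) (hd : ∑ k, d k ≤ 1)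
    (hG : G.PosSemidef) (hdG : (Matrix.diagonal (fun k => (d k : ℂ)) - G).PosSemidef) :
    2 * (G 0 2).re + 2 * (G 1 3).re - 2 * (G 0 3).im ≤ 1 / √3 := by
  have hpos : 0 < √3 := by positivity
  have hherm : ∀ i j, G j i = star (G i j) := fun i j => (hG.isHermitian.apply j i).symm
  have h20 := hherm 0 2
  have h21 := hherm 1 2
  have h30 := hherm 0 3
  have h31 := hherm 1 3
  have h10 := hherm 0 1
  have h32 := hherm 2 3
  -- A dual certificate. Each `v` is the matching `u` with its last two entries negated, so in the
  -- sum of the four inequalities the diagonal blocks of `G` cancel. Every coordinate has total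
  -- squared modulus `4` over `u1`, `u2`, so `d` contributes `4 ∑ d`. The `G 1 2` terms cancel
  -- between the two pairs, and the remaining off-diagonal terms are `-4√3` times the left-hand side
  -- of the goal.
  have u1 := hdG.re_dotProduct_nonneg ![2, I, √3, I * √3]
  have u2 := hdG.re_dotProduct_nonneg ![0, -(I * √3), 1, -I]
  have v1 := hG.re_dotProduct_nonneg ![2, I, -√3, -(I * √3)]
  have v2 := hG.re_dotProduct_nonneg ![0, -(I * √3), -1, I]
  simp [dotProduct, mulVec, Fin.sum_univ_four, h20, h21, h30, h31, h10, h32, Complex.conj_ofNat]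
    at u1 u2 v1 v2
  rw [Fin.sum_univ_four] at hd
  rw [le_div_iff₀ hpos]
  ring_nf at u1 u2 v1 v2 ⊢
  have hs2 : √3 ^ 2 = 3 := Real.sq_sqrt (by norm_num)
  simp only [hs2] at u1 u2 v1 v2
  linarith

lemma diagSum_top {N : ℕ} (M : Matrix (Fin (N + 1)) (Fin (N + 1)) ℂ) :
    diagSum M N = M 0 (Fin.last N) := by
  rw [diagSum_natCast, Finset.sum_eq_single 0]
  · simp [Fin.last]
  · intro i _ hi
    rw [dif_neg]
    have := Fin.val_ne_of_ne hi
    simp at this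
    lia
  · simp

/-- The matrix has size `N + 2`, so diagonal `N` is the one just below the corner and only rows `0`
and `1` reach it. -/
lemma diagSum_sub_top {N : ℕ} (M : Matrix (Fin (N + 2)) (Fin (N + 2)) ℂ) :
    diagSum M N = M 0 (Fin.last N).castSucc + M 1 (Fin.last (N + 1)) := by
  rw [diagSum_natCast M N, Fin.sum_univ_succ, Fin.sum_univ_succ, Finset.sum_eq_zero]
  · rw [dif_pos (by simp), dif_pos (by simp; lia), add_zero]
    refine congrArg₂ (· + ·) (congrArg (M 0) (Fin.ext ?_)) (congrArg (M _) (Fin.ext ?_))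
    · simp
    · simp; lia
  · intro i _
    rw [dif_neg]
    simp
    lia

/-- The quantum bound. -/
lemma quantum_bound {N : ℕ} (hN : 3 ≤ N) {P : ℝ → ℝ} (hP : P ∈ quantumCorrelations N)
    {c s : ℕ → ℝ} (hcs : ∀ θ, P θ = trigPoly N c s θ) : c (N - 1) + s N ≤ 1 / √3 := by
  obtain ⟨G, d, hd, hd1, hG, hdG, hPG⟩ := exists_reduced_of_mem_quantumCorrelations hP
  have hcoeff := coeff_eq_of_expSum_eq (Finset.Icc (-(N : ℤ)) N) (complexCoeff c s) (diagSum G)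
    fun θ => by rw [← trigPoly_eq_expSum, ← hcs, hPG, phaseVec_form]
  obtain ⟨M, rfl⟩ : ∃ M, N = M + 1 := ⟨N - 1, by lia⟩
  have h1 := hcoeff (M : ℤ) (by rw [Finset.mem_Icc]; lia)
  have h2 := hcoeff ((M + 1 : ℕ) : ℤ) (by rw [Finset.mem_Icc]; lia)
  rw [complexCoeff_natCast c s (by lia), diagSum_sub_top] at h1
  rw [complexCoeff_natCast c s (by lia), diagSum_top] at h2
  -- The indices `0, 1, N-1, N`, distinct precisely because `3 ≤ N`. The remaining weights in `d`
  -- are nonnegative, so the four selected ones sum to at most `1`.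
  let e : Fin 4 → Fin (M + 1 + 1) := ![0, 1, (Fin.last M).castSucc, Fin.last (M + 1)]
  have he : Function.Injective e := by
    intro a b hab
    have hM0 : M ≠ 0 := by lia
    have hM1 : M ≠ 1 := by lia
    fin_cases a <;> fin_cases b <;> simp [e, Fin.ext_iff] at hab ⊢ <;> lia
  have hb := offDiagonal_bound (G.submatrix e e) (d ∘ e) ?_ (hG.submatrix e) ?_
  · have r1 := congrArg Complex.re h1
    have r2 := congrArg Complex.im h2
    simp at r1 r2
    simp [e] at hb ⊢
    linarith
  · simp only [Function.comp]
    rw [← hd1, ← Finset.sum_image (g := e) (f := d) he.injOn]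
    exact Finset.sum_le_sum_of_subset_of_nonneg (Finset.subset_univ _) fun i _ _ => hd i
  · refine (congrArg Matrix.PosSemidef ?_).mpr (hdG.submatrix e)
    ext i j
    simp [Matrix.diagonal_apply, he.eq_iff]

/-! ### The explicit family of large degree. -/

/-- The cosine coefficients of `explicitPoly`. -/
noncomputable def explicitCos (N : ℕ) (β : ℝ) (k : ℕ) : ℝ :=
  if k = 0 then 1 / 2 else if k < N then
    -(3 / 4) * β * (1 / 2) ^ (N - k) * Real.sin (k * (Real.pi / 2) - (N : ℝ) / 2 * Real.pi) else 0

/-- The sine coefficients of `explicitPoly`. -/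
noncomputable def explicitSin (N : ℕ) (β : ℝ) (k : ℕ) : ℝ :=
  if k < N then
    -(3 / 4) * β * (1 / 2) ^ (N - k) * Real.cos (k * (Real.pi / 2) - (N : ℝ) / 2 * Real.pi)
  else 1 / 4 * β

lemma explicitPoly_eq_trigPoly {N : ℕ} (hN : 1 ≤ N) (β θ : ℝ) :
    explicitPoly N β θ = trigPoly N (explicitCos N β) (explicitSin N β) θ := by
  obtain ⟨M, rfl⟩ : ∃ M, N = M + 1 := ⟨N - 1, by lia⟩
  rw [trigPoly, Finset.sum_Icc_succ_top (by lia), explicitPoly, Finset.mul_sum,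
    Nat.add_sub_cancel]
  have h : ∀ k ∈ Finset.Icc 1 M,
      explicitCos (M + 1) β k * Real.cos (k * θ) + explicitSin (M + 1) β k * Real.sin (k * θ)
      = -(3 / 4 * β * ((1 / 2 : ℝ) ^ (M + 1 - k) *
        Real.sin (k * (Real.pi / 2 + θ) - ((M + 1 : ℕ) : ℝ) / 2 * Real.pi))) := by
    intro k hk
    rw [Finset.mem_Icc] at hk
    have h0 : ¬ k = 0 := by lia
    have h1 : k < M + 1 := by lia
    simp only [explicitCos, explicitSin, h0, h1, if_true, if_false]
    rw [show (k : ℝ) * (Real.pi / 2 + θ) - ((M + 1 : ℕ) : ℝ) / 2 * Real.pi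
      = ((k : ℝ) * (Real.pi / 2) - ((M + 1 : ℕ) : ℝ) / 2 * Real.pi) + k * θ by ring,
      Real.sin_add]
    ring
  rw [Finset.sum_congr rfl h, Finset.sum_neg_distrib]
  simp [explicitCos, explicitSin]
  ring

lemma explicitCos_sub_one {N : ℕ} (hN : 2 ≤ N) (β : ℝ) :
    explicitCos N β (N - 1) = 3 / 8 * β := by
  obtain ⟨M, rfl⟩ : ∃ M, N = M + 1 := ⟨N - 1, by lia⟩
  have h0 : ¬ M = 0 := by lia
  have h1 : M + 1 - M = 1 := by lia
  have h2 : (M : ℝ) * (Real.pi / 2) - ((M + 1 : ℕ) : ℝ) / 2 * Real.pi = -(Real.pi / 2) := by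
    push_cast; ring
  simp only [explicitCos, Nat.add_sub_cancel, h0, h1, h2, if_false, Real.sin_neg,
    Real.sin_pi_div_two, lt_add_iff_pos_right, zero_lt_one, if_true]
  ring

/-- The imaginary-part representation of the oscillating part of `explicitPoly`. -/
lemma explicitPoly_eq_im (N : ℕ) (β θ : ℝ) :
    explicitPoly N β θ = 1 / 2 + β * (Complex.exp (-((N : ℝ) / 2 * Real.pi : ℝ) * I) *
      (1 / 4 * Complex.exp ((Real.pi / 2 + θ : ℝ) * I) ^ N - 3 / 4 *
        ∑ k ∈ Finset.Icc 1 (N - 1), (1 / 2) ^ (N - k) *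
          Complex.exp ((Real.pi / 2 + θ : ℝ) * I) ^ k)).im := by
  have key : ∀ k : ℕ, (Complex.exp (-((N : ℝ) / 2 * Real.pi : ℝ) * I) *
      Complex.exp ((Real.pi / 2 + θ : ℝ) * I) ^ k)
      = Complex.exp ((k * (Real.pi / 2 + θ) - (N : ℝ) / 2 * Real.pi : ℝ) * I) := by
    intro k
    rw [← Complex.exp_nat_mul, ← Complex.exp_add]
    congr 1
    push_cast
    ring
  have e : Complex.exp (-((N : ℝ) / 2 * Real.pi : ℝ) * I) *
      (1 / 4 * Complex.exp ((Real.pi / 2 + θ : ℝ) * I) ^ N - 3 / 4 *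
        ∑ k ∈ Finset.Icc 1 (N - 1), (1 / 2) ^ (N - k) *
          Complex.exp ((Real.pi / 2 + θ : ℝ) * I) ^ k)
      = ((1 / 4 : ℝ) : ℂ) * Complex.exp ((N * (Real.pi / 2 + θ) - (N : ℝ) / 2 * Real.pi : ℝ) * I)
        - ((3 / 4 : ℝ) : ℂ) * ∑ k ∈ Finset.Icc 1 (N - 1), (((1 / 2 : ℝ) ^ (N - k) : ℝ) : ℂ) *
          Complex.exp ((k * (Real.pi / 2 + θ) - (N : ℝ) / 2 * Real.pi : ℝ) * I) := by
    simp only [← key, mul_sub, Finset.mul_sum]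
    push_cast
    congr 1
    · ring
    · exact Finset.sum_congr rfl fun k _ => by ring
  rw [e, Complex.sub_im, Complex.im_ofReal_mul, Complex.im_ofReal_mul, Complex.im_sum]
  simp only [Complex.im_ofReal_mul, Complex.exp_ofReal_mul_I_im]
  rw [explicitPoly, show (N : ℝ) * (Real.pi / 2 + θ) - (N : ℝ) / 2 * Real.pi = N * θ by ring]
  ring

lemma geom_aux {N : ℕ} (hN : 1 ≤ N) (w : ℂ) :
    (2 * w - 1) * ∑ k ∈ Finset.Icc 1 (N - 1), (1 / 2 : ℂ) ^ (N - k) * w ^ k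
      = w ^ N - 2 * w * (1 / 2) ^ N := by
  obtain ⟨M, rfl⟩ : ∃ M, N = M + 1 := ⟨N - 1, by lia⟩
  rw [Nat.add_sub_cancel]
  clear hN
  induction M with
  | zero => simp; ring
  | succ M ih =>
    rw [Finset.sum_Icc_succ_top (by lia), mul_add]
    have h : ∑ k ∈ Finset.Icc 1 M, (1 / 2 : ℂ) ^ (M + 1 + 1 - k) * w ^ k
        = 1 / 2 * ∑ k ∈ Finset.Icc 1 M, (1 / 2 : ℂ) ^ (M + 1 - k) * w ^ k := by
      rw [Finset.mul_sum]
      refine Finset.sum_congr rfl fun k hk => ?_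
      rw [Finset.mem_Icc] at hk
      rw [show M + 1 + 1 - k = (M + 1 - k) + 1 by lia, pow_succ]
      ring
    rw [h, show M + 1 + 1 - (M + 1) = 1 by lia]
    linear_combination (1 / 2 : ℂ) * ih

/-- Multiplied by `2w - 1`, the polynomial becomes `w^N (w-2)/2 + (3/2) w 2^{-N}` by `geom_aux`. On
the unit circle `|w-2| = |2w-1| ≥ 1`, so division leaves `1/2` plus the error term. -/
lemma norm_explicit_le {N : ℕ} (hN : 1 ≤ N) {w : ℂ} (hw : ‖w‖ = 1) :
    ‖1 / 4 * w ^ N - 3 / 4 * ∑ k ∈ Finset.Icc 1 (N - 1), (1 / 2 : ℂ) ^ (N - k) * w ^ k‖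
      ≤ 1 / 2 + 3 / 2 / 2 ^ N := by
  set S := ∑ k ∈ Finset.Icc 1 (N - 1), (1 / 2 : ℂ) ^ (N - k) * w ^ k with hS
  have hg := geom_aux hN w
  have h1 : 1 ≤ ‖2 * w - 1‖ := by
    have := norm_sub_norm_le (2 * w) 1
    rw [norm_mul, hw] at this
    norm_num at this
    linarith
  have h2 : ‖w - 2‖ = ‖2 * w - 1‖ := by
    have hn : w.re * w.re + w.im * w.im = 1 := by
      rw [← Complex.normSq_apply, Complex.normSq_eq_norm_sq, hw, one_pow]
    rw [← sq_eq_sq₀ (norm_nonneg _) (norm_nonneg _), ← Complex.normSq_eq_norm_sq,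
      ← Complex.normSq_eq_norm_sq, Complex.normSq_apply, Complex.normSq_apply]
    simp
    linarith
  have e : (2 * w - 1) * (1 / 4 * w ^ N - 3 / 4 * S)
      = 1 / 2 * (w ^ N * (w - 2)) + 3 / 2 * (w * (1 / 2) ^ N) := by
    linear_combination (-3 / 4 : ℂ) * hg
  have h3 : ‖2 * w - 1‖ * ‖1 / 4 * w ^ N - 3 / 4 * S‖ ≤ 1 / 2 * ‖2 * w - 1‖ + 3 / 2 / 2 ^ N := by
    rw [← norm_mul, e]
    refine (norm_add_le _ _).trans_eq ?_
    simp [hw, h2]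
    ring
  have hp : (0 : ℝ) ≤ 3 / 2 / 2 ^ N := by positivity
  have h4 : ‖2 * w - 1‖ * ‖1 / 4 * w ^ N - 3 / 4 * S‖
      ≤ ‖2 * w - 1‖ * (1 / 2 + 3 / 2 / 2 ^ N) := by nlinarith
  exact le_of_mul_le_mul_left h4 (by linarith)

lemma scaling_pos (N : ℕ) : 0 < scaling N := by unfold scaling; positivity

lemma explicitPoly_mem_Icc {N : ℕ} (hN : 1 ≤ N) (θ : ℝ) :
    0 ≤ explicitPoly N (scaling N) θ ∧ explicitPoly N (scaling N) θ ≤ 1 := by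
  set w := Complex.exp ((Real.pi / 2 + θ : ℝ) * I) with hw
  set q := Complex.exp (-((N : ℝ) / 2 * Real.pi : ℝ) * I) *
      (1 / 4 * w ^ N - 3 / 4 * ∑ k ∈ Finset.Icc 1 (N - 1), (1 / 2) ^ (N - k) * w ^ k) with hq
  have h1 : ‖q‖ ≤ 1 / 2 + 3 / 2 / 2 ^ N := by
    rw [hq, norm_mul, ← Complex.ofReal_neg, Complex.norm_exp_ofReal_mul_I, one_mul]
    exact norm_explicit_le hN (Complex.norm_exp_ofReal_mul_I _)
  have h2 : scaling N * |q.im| ≤ 1 / 2 := by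
    have hp : (0 : ℝ) < 2 ^ N := by positivity
    have h3 : |q.im| ≤ 1 / 2 * (1 + 9 / 2 ^ N) := by
      refine (Complex.abs_im_le_norm q).trans (h1.trans ?_)
      -- There is slack here: the norm bound would already allow `3` in place of the `9` in
      -- `scaling`.
      have : (3 : ℝ) / 2 / 2 ^ N ≤ 9 / 2 / 2 ^ N := by gcongr; norm_num
      linarith [this, show (9 : ℝ) / 2 / 2 ^ N = 1 / 2 * (9 / 2 ^ N) by ring]
    rw [scaling, one_div_mul_eq_div, div_le_iff₀ (by positivity)]
    exact h3
  have h4 : |scaling N * q.im| ≤ 1 / 2 := by rwa [abs_mul, abs_of_pos (scaling_pos N)]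
  rw [abs_le] at h4
  rw [explicitPoly_eq_im, ← hw, ← hq]
  constructor <;> linarith [h4.1, h4.2]

lemma one_div_sqrt_three_lt : 1 / √3 < 0.5774 := by
  -- Just sharp enough: `0.5774 · 1.732 ≈ 1.00006`.
  have h : (1.732 : ℝ) < √3 := by rw [Real.lt_sqrt] <;> norm_num
  rw [div_lt_iff₀ (by positivity)]
  nlinarith [Real.mul_self_sqrt (show (0 : ℝ) ≤ 3 by norm_num)]

/-- At `N = 7` the right side is about `0.584`, and it increases with `N`; at `N = 6` it is only
about `0.548`, so smaller degrees need separate examples. -/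
lemma scaling_violation {N : ℕ} (hN : 7 ≤ N) : 1 / √3 < 0.625 * scaling N := by
  have h2 : (2 : ℝ) ^ 7 ≤ 2 ^ N := pow_le_pow_right₀ (by norm_num) hN
  have h3 : (9 : ℝ) / 2 ^ N ≤ 9 / 2 ^ 7 := by gcongr
  have h4 : 1 / (1 + 9 / 2 ^ 7) ≤ scaling N := by
    unfold scaling
    have : (0 : ℝ) < 9 / 2 ^ N := by positivity
    gcongr
  have h5 := one_div_sqrt_three_lt
  norm_num at h4 h5 ⊢
  linarith

/-! ### Positive semidefinite certificates for the four small spins. -/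

/-- A matrix with an `LDLᴴ` decomposition with nonnegative pivots is positive semidefinite. -/
lemma posSemidef_of_ldl {n : ℕ} {M : Matrix (Fin n) (Fin n) ℂ} (d : Fin n → ℝ)
    (L : Matrix (Fin n) (Fin n) ℂ) (hd : ∀ k, 0 ≤ d k)
    (h : ∀ i j, ∑ k, star (L k i) * d k * L k j = M i j) : M.PosSemidef := by
  have hD : (Matrix.diagonal fun k => (d k : ℂ)).PosSemidef :=
    Matrix.PosSemidef.diagonal fun k => by simpa using hd k
  refine (congrArg Matrix.PosSemidef ?_).mpr (hD.conjTranspose_mul_mul_same L)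
  ext i j
  simp [← h, Matrix.mul_apply, Matrix.diagonal_apply]

lemma posSemidef_Q3 : Q3.PosSemidef := by
  -- Rank one: a single pivot, with zero rows as padding. `S3` likewise has rank two.
  refine Matrix.PosSemidef.smul (posSemidef_of_ldl ![16, 0, 0, 0]
    !![1, -3 / 4 * I, 3 / 4, -I;
     0, 0, 0, 0;
     0, 0, 0, 0;
     0, 0, 0, 0] ?_ ?_) (by positivity)
  · intro k
    fin_cases k <;> simp
  · intro i j
    fin_cases i <;> fin_cases j <;> rw [Complex.ext_iff] <;> constructor <;>
      simp [Fin.sum_univ_four, Complex.conj_ofNat] <;> norm_num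

lemma posSemidef_S3 : S3.PosSemidef := by
  refine Matrix.PosSemidef.smul (posSemidef_of_ldl ![24, 40 / 3, 0, 0]
    !![1, 1 / 12 * I, -1 / 2, 2 / 3 * I;
     0, 1, 3 / 4 * I, -1;
     0, 0, 0, 0;
     0, 0, 0, 0] ?_ ?_) (by positivity)
  · intro k
    fin_cases k <;> simp <;> norm_num
  · intro i j
    fin_cases i <;> fin_cases j <;> rw [Complex.ext_iff] <;> constructor <;>
      simp [Fin.sum_univ_four, Complex.conj_ofNat] <;> norm_num

set_option maxHeartbeats 4000000 in
lemma posSemidef_Q4 : Q4.PosSemidef := by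
  -- Full rank: exact elimination over `ℚ(i)` gives positive rational pivots and a unit triangular
  -- factor.
  refine Matrix.PosSemidef.smul (posSemidef_of_ldl ![15708, 101174539 / 15708, 8015512299 / 101174539, 374881780228 / 8015512299, 5566632871044 / 93720445057]
    !![1, -359 / 3927 - 4105 / 15708 * I, 67 / 748 - 695 / 2618 * I, 2375 / 3927, -1000 / 1309 * I;
     0, 1, -19244310 / 101174539 + 52717485 / 101174539 * I, -30560312 / 101174539 - 44652380 / 101174539 * I, 99966000 / 101174539 - 17232000 / 101174539 * I;
     0, 0, 1, -385939036 / 8015512299 + 2894923205 / 8015512299 * I, 116813791 / 2671837433 + 411637290 / 2671837433 * I;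
     0, 0, 0, 1, -8475750681 / 187440890114 + 28514644230 / 93720445057 * I;
     0, 0, 0, 0, 1] ?_ ?_) (by positivity)
  · intro k
    fin_cases k <;> simp <;> norm_num
  · intro i j
    fin_cases i <;> fin_cases j <;> rw [Complex.ext_iff] <;> constructor <;>
      simp [Fin.sum_univ_five, Complex.conj_ofNat] <;> norm_num

set_option maxHeartbeats 4000000 in
lemma posSemidef_Q5 : Q5.PosSemidef := by
  refine Matrix.PosSemidef.smul (posSemidef_of_ldl ![1663, 1127196 / 1663, 10632 / 3479, 130537 / 95688, 5852507 / 4699332, 17668671 / 5852507]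
    !![1, -319 / 1663 * I, -22 / 1663, -374 / 1663 * I, 922 / 1663, -1279 / 1663 * I;
     0, 1, 18026 / 31311 * I, -42925 / 93933, -648337 / 1127196 * I, 7655 / 7668;
     0, 0, 1, 18073 / 31896 * I, -73807 / 95688, -7105 / 15948 * I;
     0, 0, 0, 1, -242489 / 391611 * I, 33238 / 130537;
     0, 0, 0, 0, 1, -1698189 / 5852507 * I;
     0, 0, 0, 0, 0, 1] ?_ ?_) (by positivity)
  · intro k
    fin_cases k <;> simp <;> norm_num
  · intro i j
    fin_cases i <;> fin_cases j <;> rw [Complex.ext_iff] <;> constructor <;>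
      simp [Fin.sum_univ_six, Complex.conj_ofNat] <;> norm_num

set_option maxHeartbeats 4000000 in
lemma posSemidef_S5 : S5.PosSemidef := by
  refine Matrix.PosSemidef.smul (posSemidef_of_ldl ![1464, 167749 / 488, 355310 / 167749, 700564 / 532965, 1363493 / 700564, 2708270 / 1363493]
    !![1, -221 / 488 * I, 45 / 122, 617 / 1464 * I, -461 / 732, 1279 / 1464 * I;
     0, 1, 70492 / 167749 * I, -283 / 167749, 70538 / 167749 * I, -167277 / 167749;
     0, 0, 1, 98497 / 177655 * I, 57167 / 355310, 20018 / 35531 * I;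
     0, 0, 0, 1, 457103 / 700564 * I, -72485 / 350282;
     0, 0, 0, 0, 1, -1413326 / 1363493 * I;
     0, 0, 0, 0, 0, 1] ?_ ?_) (by positivity)
  · intro k
    fin_cases k <;> simp <;> norm_num
  · intro i j
    fin_cases i <;> fin_cases j <;> rw [Complex.ext_iff] <;> constructor <;>
      simp [Fin.sum_univ_six, Complex.conj_ofNat] <;> norm_num

set_option maxHeartbeats 4000000 in
lemma posSemidef_Q6 : Q6.PosSemidef := by
  refine Matrix.PosSemidef.smul (posSemidef_of_ldl ![1560, 224983 / 390, 889012 / 224983, 9686801 / 3556048, 25358318 / 9686801, 36980746 / 12679159, 48569556 / 18490373]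
    !![1, 4 / 195 - 229 / 780 * I, 73 / 520 + 97 / 1560 * I, -11 / 78 + 97 / 1560 * I, -4 / 195 - 23 / 78 * I, 469 / 780, -619 / 780 * I;
     0, 1, 24949 / 449966 + 223637 / 449966 * I, -113887 / 449966 + 27924 / 224983 * I, -55534 / 224983 - 30486 / 224983 * I, 17456 / 224983 - 111301 / 224983 * I, 224069 / 224983 + 9904 / 224983 * I;
     0, 0, 1, 40841 / 444506 + 524443 / 1778024 * I, -71571 / 1778024 + 67449 / 1778024 * I, -36289 / 444506 - 68209 / 444506 * I, 112667 / 889012 - 232023 / 444506 * I;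
     0, 0, 0, 1, 2566991 / 9686801 + 2203141 / 9686801 * I, 854244 / 9686801 + 2163308 / 9686801 * I, -695324 / 9686801 + 1721390 / 9686801 * I;
     0, 0, 0, 0, 1, -2779212 / 12679159 - 1171699 / 12679159 * I, -3650358 / 12679159 - 1041027 / 12679159 * I;
     0, 0, 0, 0, 0, 1, -3585836 / 18490373 - 760737 / 18490373 * I;
     0, 0, 0, 0, 0, 0, 1] ?_ ?_) (by positivity)
  · intro k
    fin_cases k <;> simp <;> norm_num
  · intro i j
    fin_cases i <;> fin_cases j <;> rw [Complex.ext_iff] <;> constructor <;>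
      simp [Fin.sum_univ_seven, Complex.conj_ofNat] <;> norm_num

/-- In terms of `P`, transposition is `θ ↦ -θ` and conjugation by alternating signs is `θ ↦ θ + π`.
For `N = 4, 6` the examples satisfy `1 - P(θ) = P(π - θ)`, so `S` inherits positivity from `Q`. -/
lemma posSemidef_of_alternating {n : ℕ} {Q S : Matrix (Fin n) (Fin n) ℂ} (hQ : Q.PosSemidef)
    (h : ∀ i j, S i j = (-1) ^ (i : ℕ) * (-1) ^ (j : ℕ) * Q j i) : S.PosSemidef := by
  refine (congrArg Matrix.PosSemidef ?_).mpr
    (hQ.transpose.conjTranspose_mul_mul_same (Matrix.diagonal fun i => (-1) ^ (i : ℕ)))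
  ext i j
  rw [diagonal_conjTranspose, mul_diagonal, diagonal_mul, h]
  simp
  ring

lemma posSemidef_S4 : S4.PosSemidef := by
  refine posSemidef_of_alternating posSemidef_Q4 fun i j => ?_
  fin_cases i <;> fin_cases j <;> simp [S4, Q4] <;> ring

lemma posSemidef_S6 : S6.PosSemidef := by
  refine posSemidef_of_alternating posSemidef_Q6 fun i j => ?_
  fin_cases i <;> fin_cases j <;> simp [S6, Q6] <;> ring

/-- It suffices to compare the coefficients with nonnegative index. -/
lemma isCertificate_of_natCast {N : ℕ} {c s : ℕ → ℝ} {Q S : Matrix (Fin (N + 1)) (Fin (N + 1)) ℂ}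
    (hQ : Q.PosSemidef) (hS : S.PosSemidef)
    (hQ0 : (c 0 : ℂ) = Q.trace) (hS0 : 1 - (c 0 : ℂ) = S.trace)
    (hQk : ∀ k, 1 ≤ k → k ≤ N → ((c k : ℂ) - I * s k) / 2 = diagSum Q k)
    (hSk : ∀ k, 1 ≤ k → k ≤ N → ((c k : ℂ) - I * s k) / 2 = -diagSum S k) :
    IsCertificate N c s Q S := by
  -- Negative indices follow by conjugation, since `M` is Hermitian. No positivity is used, so this
  -- applies to `-S` as well.
  have key : ∀ M : Matrix (Fin (N + 1)) (Fin (N + 1)) ℂ, M.IsHermitian →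
      (∀ k : ℕ, 1 ≤ k → k ≤ N → ((c k : ℂ) - I * s k) / 2 = diagSum M k) →
      ∀ k : ℤ, -(N : ℤ) ≤ k → k ≤ (N : ℤ) → k ≠ 0 → complexCoeff c s k = diagSum M k := by
    intro M hM h k h1 h2 h0
    rcases lt_or_gt_of_ne h0 with hk | hk
    · obtain ⟨m, rfl⟩ : ∃ m : ℕ, k = -(m : ℤ) := ⟨k.natAbs, by lia⟩
      rw [complexCoeff_neg_natCast c s (by lia), ← star_diagSum hM, ← h m (by lia) (by lia)]
      simp
    · obtain ⟨m, rfl⟩ : ∃ m : ℕ, k = (m : ℤ) := ⟨k.natAbs, by lia⟩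
      rw [complexCoeff_natCast c s (by lia), h m (by lia) (by lia)]
  have hneg : ∀ k, diagSum (-S) k = -diagSum S k := by
    intro k
    simp only [diagSum, ← Finset.sum_neg_distrib]
    refine Finset.sum_congr rfl fun i _ => Finset.sum_congr rfl fun j _ => ?_
    split_ifs <;> simp
  refine ⟨hQ, hS, fun k h1 h2 => ?_, by simpa [complexCoeff] using hS0, fun k h1 h2 h0 => ?_⟩
  · rcases eq_or_ne k 0 with rfl | h0
    · rw [diagSum_zero, ← hQ0]; simp [complexCoeff]
    · exact key Q hQ.isHermitian hQk k h1 h2 h0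
  · rw [← hneg]
    exact key (-S) hS.isHermitian.neg (fun k h1 h2 => by rw [hneg]; exact hSk k h1 h2) k h1 h2 h0

lemma IsCertificate.isCertifiedGap {N : ℕ} {c s : ℕ → ℝ}
    {Q S : Matrix (Fin (N + 1)) (Fin (N + 1)) ℂ} (hN : 3 ≤ N) (h : IsCertificate N c s Q S)
    (hgap : 1 / √3 < c (N - 1) + s N) : IsCertifiedGap N c s Q S :=
  ⟨h, h.mem_generalCorrelations, hgap,
    fun hq => hgap.not_ge (quantum_bound hN hq fun _ => rfl)⟩

lemma isCertifiedGap_three : IsCertifiedGap 3 c3 s3 Q3 S3 := by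
  refine (isCertificate_of_natCast posSemidef_Q3 posSemidef_S3 ?_ ?_ ?_ ?_).isCertifiedGap
    (by norm_num) (one_div_sqrt_three_lt.trans ?_)
  · simp [c3, coeffs, Q3, Matrix.trace, Fin.sum_univ_four]; norm_num
  · simp [c3, coeffs, S3, Matrix.trace, Fin.sum_univ_four]; norm_num
  · intro k h1 h2
    rw [diagSum_natCast]
    interval_cases k <;> simp [c3, s3, coeffs, Q3, Fin.sum_univ_four] <;> ring
  · intro k h1 h2
    rw [diagSum_natCast]
    interval_cases k <;> simp [c3, s3, coeffs, S3, Fin.sum_univ_four] <;> ring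
  · simp [c3, s3, coeffs]; norm_num

lemma isCertifiedGap_four : IsCertifiedGap 4 c4 s4 Q4 S4 := by
  refine (isCertificate_of_natCast posSemidef_Q4 posSemidef_S4 ?_ ?_ ?_ ?_).isCertifiedGap
    (by norm_num) (one_div_sqrt_three_lt.trans ?_)
  · simp [c4, coeffs, Q4, Matrix.trace, Fin.sum_univ_five]; norm_num
  · simp [c4, coeffs, S4, Matrix.trace, Fin.sum_univ_five]; norm_num
  · intro k h1 h2
    rw [diagSum_natCast]
    interval_cases k <;> simp [c4, s4, coeffs, Q4, Fin.sum_univ_five] <;> ring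
  · intro k h1 h2
    rw [diagSum_natCast]
    interval_cases k <;> simp [c4, s4, coeffs, S4, Fin.sum_univ_five] <;> ring
  · simp [c4, s4, coeffs]; norm_num

lemma isCertifiedGap_five : IsCertifiedGap 5 c5 s5 Q5 S5 := by
  refine (isCertificate_of_natCast posSemidef_Q5 posSemidef_S5 ?_ ?_ ?_ ?_).isCertifiedGap
    (by norm_num) (one_div_sqrt_three_lt.trans ?_)
  · simp [c5, coeffs, Q5, Matrix.trace, Fin.sum_univ_six]; norm_num
  · simp [c5, coeffs, S5, Matrix.trace, Fin.sum_univ_six]; norm_num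
  · intro k h1 h2
    rw [diagSum_natCast]
    interval_cases k <;> simp [c5, s5, coeffs, Q5, Fin.sum_univ_six] <;> ring
  · intro k h1 h2
    rw [diagSum_natCast]
    interval_cases k <;> simp [c5, s5, coeffs, S5, Fin.sum_univ_six] <;> ring
  · simp [c5, s5, coeffs]; norm_num

lemma isCertifiedGap_six : IsCertifiedGap 6 c6 s6 Q6 S6 := by
  refine (isCertificate_of_natCast posSemidef_Q6 posSemidef_S6 ?_ ?_ ?_ ?_).isCertifiedGap
    (by norm_num) (one_div_sqrt_three_lt.trans ?_)
  · simp [c6, coeffs, Q6, Matrix.trace, Fin.sum_univ_seven]; norm_num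
  · simp [c6, coeffs, S6, Matrix.trace, Fin.sum_univ_seven]; norm_num
  · intro k h1 h2
    rw [diagSum_natCast]
    interval_cases k <;> simp [c6, s6, coeffs, Q6, Fin.sum_univ_seven] <;> ring
  · intro k h1 h2
    rw [diagSum_natCast]
    interval_cases k <;> simp [c6, s6, coeffs, S6, Fin.sum_univ_seven] <;> ring
  · simp [c6, s6, coeffs]; norm_num

/-! ### Strictness of the inclusion. -/

lemma explicitPoly_mem_generalCorrelations {N : ℕ} (hN : 1 ≤ N) :
    explicitPoly N (scaling N) ∈ generalCorrelations N :=
  ⟨⟨_, _, explicitPoly_eq_trigPoly hN _⟩, explicitPoly_mem_Icc hN⟩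

lemma explicitSin_self (N : ℕ) (β : ℝ) : explicitSin N β N = 1 / 4 * β := by
  simp [explicitSin]

lemma explicit_sum {N : ℕ} (hN : 2 ≤ N) (β : ℝ) :
    explicitCos N β (N - 1) + explicitSin N β N = 0.625 * β := by
  rw [explicitCos_sub_one hN, explicitSin_self]
  ring

lemma explicitPoly_notMem_quantumCorrelations {N : ℕ} (hN : 7 ≤ N) :
    explicitPoly N (scaling N) ∉ quantumCorrelations N := by
  intro hq
  have h := quantum_bound (by lia) hq (explicitPoly_eq_trigPoly (by lia) _)
  rw [explicit_sum (by lia)] at h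
  exact (scaling_violation hN).not_ge h

lemma quantumCorrelations_ne {N : ℕ} (hN : 3 ≤ N) :
    quantumCorrelations N ≠ generalCorrelations N := by
  have aux : ∀ P ∈ generalCorrelations N, P ∉ quantumCorrelations N →
      quantumCorrelations N ≠ generalCorrelations N := fun P h1 h2 h => h2 (h ▸ h1)
  rcases lt_or_ge N 7 with h7 | h7
  · interval_cases N
    · exact aux _ isCertifiedGap_three.2.1 isCertifiedGap_three.2.2.2
    · exact aux _ isCertifiedGap_four.2.1 isCertifiedGap_four.2.2.2
    · exact aux _ isCertifiedGap_five.2.1 isCertifiedGap_five.2.2.2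
    · exact aux _ isCertifiedGap_six.2.1 isCertifiedGap_six.2.2.2
  · exact aux _ (explicitPoly_mem_generalCorrelations (by lia))
      (explicitPoly_notMem_quantumCorrelations h7)

end RotationBox

theorem mainTheorem3 :
    -- the quantum bound, for every `J ≥ 3/2`
    (∀ N : ℕ, 3 ≤ N → ∀ P ∈ RotationBox.quantumCorrelations N, ∀ c s : ℕ → ℝ,
      (∀ θ, P θ = RotationBox.trigPoly N c s θ) → c (N - 1) + s N ≤ 1 / √3) ∧
    -- the explicit violation, for every `J ≥ 7/2`
    (∀ N : ℕ, 7 ≤ N →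
      RotationBox.explicitPoly N (RotationBox.scaling N) ∈ RotationBox.generalCorrelations N ∧
      (∃ c s : ℕ → ℝ,
        (∀ θ, RotationBox.explicitPoly N (RotationBox.scaling N) θ
          = RotationBox.trigPoly N c s θ) ∧
        c (N - 1) = 3 / 8 * RotationBox.scaling N ∧
        s N = 1 / 4 * RotationBox.scaling N ∧
        c (N - 1) + s N = 0.625 * RotationBox.scaling N) ∧
      1 / √3 < 0.625 * RotationBox.scaling N ∧
      RotationBox.explicitPoly N (RotationBox.scaling N) ∉ RotationBox.quantumCorrelations N) ∧
    -- the certified violations for `J = 3/2, 2, 5/2, 3`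
    RotationBox.IsCertifiedGap 3 RotationBox.c3 RotationBox.s3 RotationBox.Q3 RotationBox.S3 ∧
    RotationBox.IsCertifiedGap 4 RotationBox.c4 RotationBox.s4 RotationBox.Q4 RotationBox.S4 ∧
    RotationBox.IsCertifiedGap 5 RotationBox.c5 RotationBox.s5 RotationBox.Q5 RotationBox.S5 ∧
    RotationBox.IsCertifiedGap 6 RotationBox.c6 RotationBox.s6 RotationBox.Q6 RotationBox.S6 ∧
    -- the gap, for every `J ≥ 3/2`
    (∀ N : ℕ, 3 ≤ N →
      RotationBox.quantumCorrelations N ⊆ RotationBox.generalCorrelations N ∧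
      RotationBox.quantumCorrelations N ≠ RotationBox.generalCorrelations N) := by 
  refine ⟨fun N hN P hP c s h => RotationBox.quantum_bound hN hP h, fun N hN => ?_,
    RotationBox.isCertifiedGap_three, RotationBox.isCertifiedGap_four,
    RotationBox.isCertifiedGap_five, RotationBox.isCertifiedGap_six,
    fun N hN => ⟨RotationBox.quantumCorrelations_subset N, RotationBox.quantumCorrelations_ne hN⟩⟩
  exact ⟨RotationBox.explicitPoly_mem_generalCorrelations (by lia),
    ⟨RotationBox.explicitCos N _, RotationBox.explicitSin N _,
      RotationBox.explicitPoly_eq_trigPoly (by lia) _, RotationBox.explicitCos_sub_one (by lia) _,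
      RotationBox.explicitSin_self N _, RotationBox.explicit_sum (by lia) _⟩,
    RotationBox.scaling_violation hN, RotationBox.explicitPoly_notMem_quantumCorrelations hN⟩
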